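/- Let $n\ge 1$ and let $C:\mathbb R^n\to\mathbb R$ be strictly convex and $q$-homogeneous, that is, $C(\lambda x)=\lambda^q C(x)$ for all $\lambda\ge 0$ and $x\in\mathbb R^n$, where $q\in\mathbb R$ (these assumptions force $q>1$). Let $p$ be defined by $\frac1p+\frac1q=1$, let $C^*(y)=\sup_{z\in\mathbb R^n}\{z\cdot y-C(z)\}$ be the Fenchel–Legendre transform of $C$, and put $\mathcal L=\int_{\mathbb R^n}e^{-C(x)}\,dx$. Then for every function $g:\mathbb R^n\to\mathbb R$ of class $\mathcal C^1$ such that $e^g$, $g\,e^g$ and $C^*(-\nabla g)\,e^g$ are integrable with respect to Lebesgue measure, the Euclidean logarithmic Sobolev inequality $$\mathrm{Ent}_{dx}(e^g)\;\le\;\frac np\int_{\mathbb R^n} e^g\,dx\;\log\left(\frac{p}{n\,e^{p-1}\,\mathcal L^{p/n}}\cdot\frac{\int_{\mathbb R^n} C^*(-\nabla g)\,e^g\,dx}{\int_{\mathbb R^n} e^g\,dx}\right)$$ holds, where $\mathrm{Ent}_{dx}(e^g)=\int_{\mathbb R^n} e^g\log\frac{e^g}{\int_{\mathbb R^n} e^g\,dy}\,dx$.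 -/

import Mathlib

open MeasureTheory

noncomputable section

namespace LogSobolev

/-- The Fenchel-Legendre transform `C*(y) = sup_z (z · y - C z)` of a real function on `ℝⁿ`.
For functions growing faster than linearly at infinity the supremum is finite, so that the
real-valued supremum is the usual one. -/
def legendre {n : ℕ} (C : EuclideanSpace ℝ (Fin n) → ℝ) (y : EuclideanSpace ℝ (Fin n)) : ℝ :=
  ⨆ z : EuclideanSpace ℝ (Fin n), (inner ℝ z y - C z)

/-- The entropy `Ent_μ(f) = ∫ f log (f / ∫ f dμ) dμ` of a function with respect to `μ`. -/
def entropy {X : Type*} [MeasurableSpace X] (μ : Measure X) (f : X → ℝ) : ℝ :=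
  ∫ x, f x * Real.log (f x / ∫ y, f y ∂μ) ∂μ

/-- `C (lam x) = lam ^ q C x` for all real `lam ≥ 0` and all `x`. -/
def IsHomogeneousOfDegree {n : ℕ} (q : ℝ) (C : EuclideanSpace ℝ (Fin n) → ℝ) : Prop :=
  ∀ lam : ℝ, 0 ≤ lam → ∀ x : EuclideanSpace ℝ (Fin n), C (lam • x) = lam ^ q * C x

end LogSobolev

end

/-! The proof is by mass transport, one coordinate at a time. Let `m` and `k` be the first marginals
of `e^g` and `e^{-C}`, with total masses `M` and `L`, and let `T` be the increasing map with `m =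
(M/L) k(T) T'`. Taking logarithms and using `log T' ≤ T' - 1` controls `m (log m - log k(T))`
(`mul_log_le_of_transport`). On the slice at `t`, induction on the dimension compares `g(t, ·)` with
`C(T t, ·)`, at the cost of an extra term `T ∂₁g`. After integration in `t`, integration by parts
gives `∫ T' e^g = -∫ T ∂₁g e^g`, so the two extra terms cancel, and each coordinate contributes one
`-1`. The result is the nonhomogeneous inequality `integral_mul_exp_le_of_young`.

Applied to `C(·/r)`, it has mass `r^n L` and Legendre transform `r^p C*`; optimising over `r`
produces the logarithm (`le_mul_log_of_forall_dilation`). Homogeneity and strict convexity make `C`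
comparable to `‖x‖^q` and bound `C*` below by a multiple of `‖y‖^p`, which supplies the
integrability needed throughout. -/

namespace LogSobolev

open Filter Topology Set

/-! ### Monotone transport on the line -/

/-- A positive continuous integrable density on the line has a distribution function. -/
lemma exists_primitive_of_integrable {f : ℝ → ℝ} (hf : Continuous f) (hfi : Integrable f) :
    ∃ F : ℝ → ℝ, (∀ t, HasDerivAt F (f t) t) ∧ Tendsto F atBot (𝓝 0) ∧
      Tendsto F atTop (𝓝 (∫ x, f x)) := by
  refine ⟨fun t => ∫ x in Iic t, f x, fun t => ?_, ?_, ?_⟩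
  · have h : (fun t => ∫ x in Iic t, f x) = fun t => (∫ x in Iic 0, f x) + ∫ x in (0 : ℝ)..t, f x := by
      funext s
      rw [← intervalIntegral.integral_Iic_sub_Iic hfi.integrableOn hfi.integrableOn]
      ring
    rw [h]
    exact (intervalIntegral.integral_hasDerivAt_right (hf.intervalIntegrable _ _)
      (hf.stronglyMeasurableAtFilter _ _) hf.continuousAt).const_add _
  · have h : (fun t => ∫ x in Iic t, f x) = fun t => (∫ x, f x) - ∫ x in Ioi t, f x := by
      funext s
      rw [← integral_add_compl (s := Iic s) measurableSet_Iic hfi, compl_Iic]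
      ring
    rw [h]
    have := (aecover_Ioi (μ := volume) (tendsto_id (α := ℝ) (x := atBot))).integral_tendsto_of_countably_generated hfi
    simpa using this.const_sub (∫ x, f x)
  · exact (aecover_Iic (μ := volume) (tendsto_id (α := ℝ) (x := atTop))).integral_tendsto_of_countably_generated hfi

lemma strictMono_image_eq_Ioo {F f : ℝ → ℝ} {M : ℝ} (hF : ∀ t, HasDerivAt F (f t) t)
    (hpos : ∀ t, 0 < f t) (hbot : Tendsto F atBot (𝓝 0)) (htop : Tendsto F atTop (𝓝 M)) :
    StrictMono F ∧ range F = Ioo 0 M := by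
  have hmono : StrictMono F := strictMono_of_hasDerivAt_pos hF hpos
  refine ⟨hmono, ?_⟩
  ext y
  constructor
  · rintro ⟨t, rfl⟩
    exact ⟨(hmono.monotone.le_of_tendsto hbot (t - 1)).trans_lt (hmono (by linarith)),
      (hmono (by linarith : t < t + 1)).trans_le (hmono.monotone.ge_of_tendsto htop (t + 1))⟩
  · rintro ⟨h0, h1⟩
    obtain ⟨a, ha⟩ := (hbot.eventually (gt_mem_nhds h0)).exists
    obtain ⟨b, hb⟩ := (htop.eventually (lt_mem_nhds h1)).exists
    have hc : Continuous F := continuous_iff_continuousAt.2 fun t => (hF t).continuousAt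
    exact mem_range_of_exists_le_of_exists_ge hc ⟨a, ha.le⟩ ⟨b, hb.le⟩

/-- The increasing transport between two positive continuous densities on the line. -/
lemma exists_transport {f k : ℝ → ℝ} (hf : Continuous f) (hk : Continuous k)
    (hfp : ∀ t, 0 < f t) (hkp : ∀ t, 0 < k t) (hfi : Integrable f) (hki : Integrable k) :
    ∃ T T' : ℝ → ℝ, Continuous T' ∧ (∀ t, HasDerivAt T (T' t) t) ∧ (∀ t, 0 < T' t) ∧
      ∀ t, f t = (∫ x, f x) / (∫ x, k x) * (k (T t) * T' t) := by
  have hM : 0 < ∫ x, f x := (integral_pos_iff_support_of_nonneg (fun t => (hfp t).le) hfi).2 (by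
    rw [Function.support_eq_univ fun t => (hfp t).ne']; simp)
  have hL : 0 < ∫ x, k x := (integral_pos_iff_support_of_nonneg (fun t => (hkp t).le) hki).2 (by
    rw [Function.support_eq_univ fun t => (hkp t).ne']; simp)
  set M := ∫ x, f x
  set L := ∫ x, k x
  have hc : 0 < M / L := div_pos hM hL
  obtain ⟨F, hF, hF0, hF1⟩ := exists_primitive_of_integrable hf hfi
  -- The factor `M / L` equalises the masses, so `F` and `K` both have range `(0, M)` and the
  -- transport is `K⁻¹ ∘ F`.
  obtain ⟨K, hK, hK0, hK1⟩ := exists_primitive_of_integrable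
    (hk.const_mul (M / L)) (hki.const_mul (M / L))
  have hK1' : Tendsto K atTop (𝓝 M) := by
    convert hK1 using 2
    rw [integral_const_mul]
    exact (div_mul_cancel₀ M hL.ne').symm
  obtain ⟨hFm, hFr⟩ := strictMono_image_eq_Ioo hF hfp hF0 hF1
  obtain ⟨hKm, hKr⟩ := strictMono_image_eq_Ioo hK (fun t => mul_pos hc (hkp t)) hK0 hK1'
  have hFmem : ∀ t, F t ∈ Ioo 0 M := fun t => hFr ▸ mem_range_self t
  have hex : ∀ y, ∃ s, y ∈ Ioo 0 M → K s = y := fun y => by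
    by_cases hy : y ∈ Ioo 0 M
    · obtain ⟨s, hs⟩ : y ∈ range K := hKr ▸ hy
      exact ⟨s, fun _ => hs⟩
    · exact ⟨0, fun h => (hy h).elim⟩
  choose S hS using hex
  have hSK : ∀ s, S (K s) = s := fun s =>
    hKm.injective (hS _ (hKr ▸ mem_range_self s))
  have hSm : StrictMonoOn S (Ioo 0 M) := fun x hx y hy hxy => by
    rw [← hKm.lt_iff_lt, hS x hx, hS y hy]; exact hxy
  have hSc : ∀ y ∈ Ioo 0 M, ContinuousAt S y := fun y hy =>
    hSm.continuousAt_of_image_mem_nhds (isOpen_Ioo.mem_nhds hy) (by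
      convert univ_mem
      exact eq_univ_of_forall fun s => ⟨K s, hKr ▸ mem_range_self s, hSK s⟩)
  have hSd : ∀ y ∈ Ioo 0 M, HasDerivAt S (M / L * k (S y))⁻¹ y := fun y hy =>
    HasDerivAt.of_local_left_inverse (hSc y hy) (hK (S y)) (mul_pos hc (hkp _)).ne' (by
      filter_upwards [isOpen_Ioo.mem_nhds hy] with z hz using hS z hz)
  have hTd : ∀ t, HasDerivAt (fun t => S (F t)) ((M / L * k (S (F t)))⁻¹ * f t) t := fun t =>
    (hSd _ (hFmem t)).comp t (hF t)
  have hTc : Continuous fun t => S (F t) :=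
    continuous_iff_continuousAt.2 fun t => (hTd t).continuousAt
  refine ⟨fun t => S (F t), fun t => (M / L * k (S (F t)))⁻¹ * f t, ?_, hTd, fun t =>
    mul_pos (inv_pos.2 (mul_pos hc (hkp _))) (hfp t), fun t => ?_⟩
  · exact ((continuous_const.mul (hk.comp hTc)).inv₀ fun t => (mul_pos hc (hkp _)).ne').mul hf
  · have := (hkp (S (F t))).ne'
    have := hM.ne'
    have := hL.ne'
    field_simp

/-- Change of variables: integrability against the target density pulls back along a transport. -/
lemma integrable_comp_transport {f k h T T' : ℝ → ℝ} {c : ℝ}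
    (hT : ∀ t, HasDerivAt T (T' t) t) (hT' : ∀ t, 0 < T' t)
    (hfk : ∀ t, f t = c * (k (T t) * T' t)) (hi : Integrable (fun s => h s * k s)) :
    Integrable fun t => h (T t) * f t := by
  have h1 := (integrableOn_image_iff_integrableOn_abs_deriv_smul (s := univ) MeasurableSet.univ
    (fun x _ => (hT x).hasDerivWithinAt)
    (strictMono_of_hasDerivAt_pos hT hT').injective.injOn (fun s => h s * k s)).1 hi.integrableOn
  rw [integrableOn_univ] at h1
  refine (h1.const_mul c).congr (Eventually.of_forall fun t => ?_)
  simp only [smul_eq_mul, abs_of_pos (hT' t), hfk t]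
  ring

/-! ### Integration by parts, on the line and on products -/

/-- By Markov's inequality `{1 ≤ |u|}` has finite measure, so it cannot contain a half-line. This
supplies endpoints with bounded boundary terms. -/
lemma exists_abs_le_one_of_integrable {u : ℝ → ℝ} (hu : Integrable u) (N : ℝ) :
    (∃ b, N ≤ b ∧ |u b| ≤ 1) ∧ ∃ a, a ≤ N ∧ |u a| ≤ 1 := by
  have key : ∀ s : Set ℝ, MeasurableSet s → volume s = ⊤ → ∃ b ∈ s, |u b| ≤ 1 := by
    intro s hs hv
    by_contra! h
    have h2 : volume {x | (1 : ℝ) ≤ ‖u x‖} < ⊤ := hu.measure_norm_ge_lt_top one_pos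
    exact (h2.trans_le' (measure_mono fun x hx => (h x hx).le)).ne hv
  obtain ⟨b, hb, hb'⟩ := key (Ici N) measurableSet_Ici Real.volume_Ici
  obtain ⟨a, ha, ha'⟩ := key (Iic N) measurableSet_Iic Real.volume_Iic
  exact ⟨⟨b, hb, hb'⟩, a, ha, ha'⟩

/-- Integration by parts on the line when the term carrying the derivative `T'` is nonnegative;
its integrability is part of the conclusion. -/
lemma integral_deriv_mul_eq_of_nonneg {T T' f f' : ℝ → ℝ}
    (hT : ∀ t, HasDerivAt T (T' t) t) (hf : ∀ t, HasDerivAt f (f' t) t)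
    (hT'c : Continuous T') (hf'c : Continuous f')
    (hT' : ∀ t, 0 ≤ T' t) (hf0 : ∀ t, 0 ≤ f t) (hTf : Integrable fun t => T t * f t)
    (hTf' : Integrable fun t => T t * f' t) :
    Integrable (fun t => T' t * f t) ∧ ∫ t, T' t * f t = -∫ t, T t * f' t := by
  have hfc : Continuous f := continuous_iff_continuousAt.2 fun t => (hf t).continuousAt
  have hi : Integrable fun t => T' t * f t := by
    -- Along these intervals the two boundary terms contribute at most 2. As `T' f ≥ 0`, bounded
    -- integrals already give integrability.
    choose b hb hb1 using fun n : ℕ => (exists_abs_le_one_of_integrable hTf n).1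
    choose a ha ha1 using fun n : ℕ => (exists_abs_le_one_of_integrable hTf (-n)).2
    refine integrable_of_intervalIntegral_norm_bounded (l := atTop) (a := a) (b := b)
      (2 + ∫ t, |T t * f' t|) (fun i => ?_) ?_ ?_ (Eventually.of_forall fun i => ?_)
    · exact ((hT'c.mul hfc).integrableOn_Icc).mono_set Ioc_subset_Icc_self
    · exact tendsto_atBot_mono ha (tendsto_neg_atTop_atBot.comp tendsto_natCast_atTop_atTop)
    · exact tendsto_atTop_mono hb tendsto_natCast_atTop_atTop
    · have hab : a i ≤ b i := (ha i).trans ((neg_nonpos.2 i.cast_nonneg).trans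
        (i.cast_nonneg.trans (hb i)))
      have h1 := intervalIntegral.integral_mul_deriv_eq_deriv_mul (a := a i) (b := b i)
        (fun x _ => hT x) (fun x _ => hf x) (hT'c.intervalIntegrable _ _)
        (hf'c.intervalIntegrable _ _)
      have h2 : |∫ x in a i..b i, T x * f' x| ≤ ∫ t, |T t * f' t| := by
        rw [intervalIntegral.integral_of_le hab]
        exact (abs_integral_le_integral_abs).trans
          (setIntegral_le_integral hTf'.abs (Eventually.of_forall fun _ => abs_nonneg _))
      have h3 : ∀ x, ‖T' x * f x‖ = T' x * f x := fun x =>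
        Real.norm_of_nonneg (mul_nonneg (hT' x) (hf0 x))
      simp_rw [h3]
      have := abs_le.1 (ha1 i)
      have := abs_le.1 (hb1 i)
      have := abs_le.1 h2
      linarith
  refine ⟨hi, ?_⟩
  have := integral_mul_deriv_eq_deriv_mul_of_integrable (u := T) (v := f) (fun x _ => hT x)
    (fun x _ => hf x) hTf' hi hTf
  linarith

section Slices

variable {Y : Type*} [MeasurableSpace Y] {ν : Measure Y} [SFinite ν]

/-- If `f` and its derivative in the first variable are integrable on `ℝ × Y`, then all the
slices of `f` are integrable and the marginal of `f` is continuous. -/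
lemma integrable_slice_and_continuous_marginal {f D : ℝ × Y → ℝ}
    (hd : ∀ y t, HasDerivAt (fun s => f (s, y)) (D (t, y)) t)
    (hfm : ∀ t, AEStronglyMeasurable (fun y => f (t, y)) ν)
    (hf : Integrable f (volume.prod ν)) (hD : Integrable D (volume.prod ν)) :
    (∀ t, Integrable (fun y => f (t, y)) ν) ∧ Continuous fun t => ∫ y, f (t, y) ∂ν := by
  -- One integrable slice anchors all the others through the fundamental theorem of calculus. The
  -- resulting bound does not depend on `t`, so it also dominates for continuity.
  obtain ⟨s, hs⟩ := hf.prod_right_ae.exists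
  have hbound : ∀ t, ∀ᵐ y ∂ν, ‖f (t, y)‖ ≤ ‖f (s, y)‖ + ∫ r, ‖D (r, y)‖ := fun t => by
    filter_upwards [hD.prod_left_ae] with y hy
    have h1 := intervalIntegral.integral_eq_sub_of_hasDerivAt (a := s) (b := t)
      (fun x _ => hd y x) hy.intervalIntegrable
    have h2 : ‖∫ r in s..t, D (r, y)‖ ≤ ∫ r, ‖D (r, y)‖ :=
      intervalIntegral.norm_integral_le_integral_norm_uIoc.trans
        (setIntegral_le_integral hy.norm (Eventually.of_forall fun _ => norm_nonneg _))
    have h3 : f (t, y) = f (s, y) + ∫ r in s..t, D (r, y) := by rw [h1]; ring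
    rw [h3]
    exact (norm_add_le _ _).trans (add_le_add le_rfl h2)
  have hbi : Integrable (fun y => ‖f (s, y)‖ + ∫ r, ‖D (r, y)‖) ν :=
    hs.norm.add hD.norm.integral_prod_right
  refine ⟨fun t => hbi.mono' (hfm t) (hbound t), ?_⟩
  exact continuous_of_dominated hfm hbound hbi (Eventually.of_forall fun y =>
    continuous_iff_continuousAt.2 fun t => (hd y t).continuousAt)

/-- Integration by parts in the first variable on `ℝ × Y`. -/
lemma integral_prod_deriv_mul_eq_of_nonneg {f D : ℝ × Y → ℝ} {T T' : ℝ → ℝ}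
    (hd : ∀ y t, HasDerivAt (fun s => f (s, y)) (D (t, y)) t)
    (hDc : ∀ y, Continuous fun t => D (t, y)) (hf0 : ∀ x, 0 ≤ f x)
    (hT : ∀ t, HasDerivAt T (T' t) t) (hT'c : Continuous T') (hT' : ∀ t, 0 ≤ T' t)
    (hf : AEStronglyMeasurable f (volume.prod ν))
    (hTf : Integrable (fun x => T x.1 * f x) (volume.prod ν))
    (hTD : Integrable (fun x => T x.1 * D x) (volume.prod ν)) :
    Integrable (fun x => T' x.1 * f x) (volume.prod ν) ∧
      ∫ x, T' x.1 * f x ∂(volume.prod ν) = -∫ x, T x.1 * D x ∂(volume.prod ν) := by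
  have hae : ∀ᵐ y ∂ν, Integrable (fun t => T' t * f (t, y)) ∧
      ∫ t, T' t * f (t, y) = -∫ t, T t * D (t, y) := by
    filter_upwards [hTf.prod_left_ae, hTD.prod_left_ae] with y h1 h2
    exact integral_deriv_mul_eq_of_nonneg hT (hd y) hT'c (hDc y) hT' (fun t => hf0 _) h1 h2
  -- By nonnegativity, the norm integral over a slice equals `-∫ T D`, which is integrable in `y` by
  -- Fubini.
  have hi : Integrable (fun x => T' x.1 * f x) (volume.prod ν) := by
    refine (integrable_prod_iff' ?_).2 ⟨hae.mono fun y h => h.1, ?_⟩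
    · exact (hT'c.measurable.comp measurable_fst).aestronglyMeasurable.mul hf
    · refine hTD.integral_prod_right.neg.congr (hae.mono fun y h => ?_)
      simp only [Pi.neg_apply, ← h.2]
      exact integral_congr_ae (Eventually.of_forall fun t =>
        (Real.norm_of_nonneg (mul_nonneg (hT' t) (hf0 _))).symm)
  refine ⟨hi, ?_⟩
  rw [integral_prod_symm _ hi, integral_prod_symm _ hTD, ← integral_neg]
  exact integral_congr_ae (hae.mono fun y h => h.2)

end Slices

/-! ### Young's inequality and integrability of exponential weights -/

section Powers

variable {p q : ℝ}

lemma mul_le_rpow_add_rpow (hpq : p.HolderConjugate q) {a b : ℝ} (ha : 0 ≤ a) (hb : 0 ≤ b) :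
    a * b ≤ a ^ p + b ^ q :=
  (Real.young_inequality_of_nonneg ha hb hpq).trans (add_le_add
    (div_le_self (Real.rpow_nonneg ha _) hpq.lt.le)
    (div_le_self (Real.rpow_nonneg hb _) hpq.symm.lt.le))

lemma le_rpow_add_one (hpq : p.HolderConjugate q) {a : ℝ} (ha : 0 ≤ a) : a ≤ a ^ p + 1 := by
  simpa using mul_le_rpow_add_rpow hpq ha zero_le_one

end Powers

section Exponential

variable {q c : ℝ}

lemma integrable_of_even {f : ℝ → ℝ} (hf : ∀ t, f (-t) = f t) (hi : IntegrableOn f (Ioi 0)) :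
    Integrable f := by
  rw [← integrableOn_univ, ← Iic_union_Ioi (a := (0 : ℝ)), integrableOn_union]
  refine ⟨?_, hi⟩
  rw [integrableOn_Iic_iff_integrableOn_Iio]
  have h := (Measure.measurePreserving_neg (volume : Measure ℝ)).integrableOn_comp_preimage
    (MeasurableEquiv.neg ℝ).measurableEmbedding (f := f) (s := Ioi 0)
  have h' := h.2 hi
  simpa [Function.comp_def, hf] using h'

lemma integrable_abs_rpow_mul_exp (hq : 0 < q) (hc : 0 < c) {s : ℝ} (hs : 0 ≤ s) :
    Integrable fun t : ℝ => |t| ^ s * Real.exp (-(c * |t| ^ q)) := by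
  refine integrable_of_even (fun t => by simp) ?_
  refine (integrableOn_rpow_mul_exp_neg_mul_rpow (s := s) (by linarith) hq hc).congr_fun
    (fun t ht => ?_) measurableSet_Ioi
  simp [abs_of_pos (mem_Ioi.1 ht)]

lemma integrable_exp_abs_rpow (hq : 0 < q) (hc : 0 < c) :
    Integrable fun t : ℝ => Real.exp (-(c * |t| ^ q)) := by
  simpa using integrable_abs_rpow_mul_exp hq hc le_rfl

lemma integrable_exp_sum_abs_rpow (hq : 0 < q) (hc : 0 < c) (n : ℕ) :
    Integrable fun z : Fin n → ℝ => Real.exp (-(c * ∑ i, |z i| ^ q)) := by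
  have := Integrable.fintype_prod (μ := fun _ : Fin n => (volume : Measure ℝ))
    (f := fun _ t => Real.exp (-(c * |t| ^ q))) fun _ => integrable_exp_abs_rpow hq hc
  refine this.congr (Eventually.of_forall fun z => ?_)
  simp only
  rw [← Real.exp_sum, Finset.mul_sum, Finset.sum_neg_distrib]

lemma integrable_exp_neg_of_le {n : ℕ} (hq : 0 < q) (hc : 0 < c) {b : ℝ} {C : (Fin n → ℝ) → ℝ}
    (hC : Continuous C) (hCb : ∀ z, c * ∑ i, |z i| ^ q - b ≤ C z) :
    Integrable fun z => Real.exp (-C z) := by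
  refine ((integrable_exp_sum_abs_rpow hq hc n).const_mul (Real.exp b)).mono'
    (Real.continuous_exp.comp hC.neg).aestronglyMeasurable (Eventually.of_forall fun z => ?_)
  rw [Real.norm_of_nonneg (Real.exp_pos _).le, ← Real.exp_add]
  exact Real.exp_le_exp.2 (by linarith [hCb z])

end Exponential

/-! ### Splitting off the first coordinate -/

section Cons

variable {n : ℕ}

lemma cons_eq_piFinSuccAbove_symm :
    (fun x : ℝ × (Fin n → ℝ) => (Fin.cons x.1 x.2 : Fin (n + 1) → ℝ)) =
      (MeasurableEquiv.piFinSuccAbove (fun _ : Fin (n + 1) => ℝ) 0).symm := by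
  funext x
  simp only [MeasurableEquiv.piFinSuccAbove_symm_apply, Fin.insertNthEquiv_zero]
  rfl

lemma measurePreserving_cons : MeasurePreserving
    (fun x : ℝ × (Fin n → ℝ) => (Fin.cons x.1 x.2 : Fin (n + 1) → ℝ)) (volume.prod volume) volume := by
  rw [cons_eq_piFinSuccAbove_symm]
  exact (volume_preserving_piFinSuccAbove (fun _ : Fin (n + 1) => ℝ) 0).symm

lemma measurableEmbedding_cons : MeasurableEmbedding
    (fun x : ℝ × (Fin n → ℝ) => (Fin.cons x.1 x.2 : Fin (n + 1) → ℝ)) := by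
  rw [cons_eq_piFinSuccAbove_symm]
  exact (MeasurableEquiv.piFinSuccAbove (fun _ : Fin (n + 1) => ℝ) 0).symm.measurableEmbedding

lemma integrable_comp_cons {h : (Fin (n + 1) → ℝ) → ℝ} (hi : Integrable h) :
    Integrable (fun x : ℝ × (Fin n → ℝ) => h (Fin.cons x.1 x.2)) (volume.prod volume) :=
  (measurePreserving_cons.integrable_comp_emb measurableEmbedding_cons).2 hi

lemma integral_comp_cons (h : (Fin (n + 1) → ℝ) → ℝ) :
    ∫ x : ℝ × (Fin n → ℝ), h (Fin.cons x.1 x.2) ∂(volume.prod volume) = ∫ x, h x :=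
  measurePreserving_cons.integral_comp measurableEmbedding_cons h

end Cons

/-! ### The nonhomogeneous inequality, by induction on the dimension -/

/-- Logarithm of the transport equation, with `d` playing `T'`, followed by `log d ≤ d - 1`. -/
lemma mul_log_le_of_transport {m M L k d : ℝ} (hM : 0 < M) (hL : 0 < L) (hk : 0 < k) (hd : 0 < d)
    (hm0 : 0 ≤ m) (hm : m = M / L * (k * d)) :
    m * (Real.log m - Real.log k) ≤ m * (Real.log M - Real.log L - 1) + d * m := by
  have h1 : Real.log m = Real.log M - Real.log L + (Real.log k + Real.log d) := by
    rw [hm, Real.log_mul (div_pos hM hL).ne' (mul_pos hk hd).ne', Real.log_div hM.ne' hL.ne',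
      Real.log_mul hk.ne' hd.ne']
  have h2 := mul_le_mul_of_nonneg_left (Real.log_le_sub_one_of_pos hd) hm0
  rw [h1]
  linarith

section

variable {p q c b : ℝ}

/-- The marginal of `e^{-C}` on the first coordinate. -/
lemma marginal_exp_neg {n : ℕ} (hq : 0 < q) (hc : 0 < c) {C : (Fin (n + 1) → ℝ) → ℝ}
    (hC : Continuous C) (hCb : ∀ z, c * ∑ i, |z i| ^ q - b ≤ C z) :
    (∀ s, Integrable fun z : Fin n → ℝ => Real.exp (-C (Fin.cons s z))) ∧
    (Continuous fun s => ∫ z : Fin n → ℝ, Real.exp (-C (Fin.cons s z))) ∧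
    (Integrable fun s => ∫ z : Fin n → ℝ, Real.exp (-C (Fin.cons s z))) ∧
    Integrable fun s => |s| ^ q * ∫ z : Fin n → ℝ, Real.exp (-C (Fin.cons s z)) := by
  have hcons : Continuous fun x : ℝ × (Fin n → ℝ) => (Fin.cons x.1 x.2 : Fin (n + 1) → ℝ) :=
    Continuous.finCons (A := fun _ => ℝ) continuous_fst continuous_snd
  have hb1 : ∀ s (z : Fin n → ℝ), Real.exp (-C (Fin.cons s z)) ≤
      Real.exp b * Real.exp (-(c * |s| ^ q)) * Real.exp (-(c * ∑ i, |z i| ^ q)) := fun s z => by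
    rw [← Real.exp_add, ← Real.exp_add]
    have := hCb (Fin.cons s z)
    rw [Fin.sum_univ_succ] at this
    simp only [Fin.cons_zero, Fin.cons_succ] at this
    exact Real.exp_le_exp.2 (by linarith)
  have hb2 : ∀ s (z : Fin n → ℝ), Real.exp (-C (Fin.cons s z)) ≤
      Real.exp b * Real.exp (-(c * ∑ i, |z i| ^ q)) := fun s z => by
    refine (hb1 s z).trans (mul_le_mul_of_nonneg_right ?_ (Real.exp_pos _).le)
    refine mul_le_of_le_one_right (Real.exp_pos _).le (Real.exp_le_one_iff.2 ?_)
    exact neg_nonpos.2 (mul_nonneg hc.le (Real.rpow_nonneg (abs_nonneg _) _))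
  have hi2 := (integrable_exp_sum_abs_rpow hq hc n).const_mul (Real.exp b)
  have hm : ∀ s, AEStronglyMeasurable (fun z : Fin n → ℝ => Real.exp (-C (Fin.cons s z))) volume :=
    fun s => (Real.continuous_exp.comp
      (hC.comp (hcons.comp (Continuous.prodMk_right s))).neg).aestronglyMeasurable
  have hnorm : ∀ s (z : Fin n → ℝ), ‖Real.exp (-C (Fin.cons s z))‖ ≤
      Real.exp b * Real.exp (-(c * ∑ i, |z i| ^ q)) := fun s z => by
    rw [Real.norm_of_nonneg (Real.exp_pos _).le]; exact hb2 s z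
  have hs : ∀ s, Integrable fun z : Fin n → ℝ => Real.exp (-C (Fin.cons s z)) := fun s =>
    hi2.mono' (hm s) (Eventually.of_forall (hnorm s))
  have hcont : Continuous fun s => ∫ z : Fin n → ℝ, Real.exp (-C (Fin.cons s z)) :=
    continuous_of_dominated hm (fun s => Eventually.of_forall (hnorm s)) hi2
      (Eventually.of_forall fun z => Real.continuous_exp.comp
        (hC.comp (hcons.comp (Continuous.prodMk_left z))).neg)
  refine ⟨hs, hcont, ?_, ?_⟩
  · exact (integrable_comp_cons (integrable_exp_neg_of_le hq hc hC hCb)).integral_prod_left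
  · have hmaj := (integrable_abs_rpow_mul_exp hq hc hq.le).const_mul
      (Real.exp b * ∫ z : Fin n → ℝ, Real.exp (-(c * ∑ i, |z i| ^ q)))
    refine hmaj.mono' (((continuous_abs.rpow_const fun _ => Or.inr hq.le).mul
      hcont).aestronglyMeasurable) (Eventually.of_forall fun s => ?_)
    have h0 : 0 ≤ ∫ z : Fin n → ℝ, Real.exp (-C (Fin.cons s z)) :=
      integral_nonneg fun _ => (Real.exp_pos _).le
    rw [Real.norm_of_nonneg (mul_nonneg (Real.rpow_nonneg (abs_nonneg _) _) h0)]
    have := integral_mono (hs s) ((integrable_exp_sum_abs_rpow hq hc n).const_mul _) (hb1 s)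
    rw [integral_const_mul] at this
    calc _ ≤ |s| ^ q * _ := mul_le_mul_of_nonneg_left this (Real.rpow_nonneg (abs_nonneg _) _)
      _ = _ := by ring

/-- The nonhomogeneous logarithmic Sobolev inequality for `e ^ g` with partial derivatives `G i` of
`g`, in terms of a function `E` dominating the Legendre transform of `C` along `-∇ g`. -/
theorem integral_mul_exp_le_of_young (hpq : p.HolderConjugate q) (hc : 0 < c) :
    ∀ (n : ℕ) (C : (Fin n → ℝ) → ℝ) (g : (Fin n → ℝ) → ℝ) (G : Fin n → (Fin n → ℝ) → ℝ)
      (E : (Fin n → ℝ) → ℝ),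
      Continuous C → (∀ z, c * ∑ i, |z i| ^ q - b ≤ C z) → Continuous g → (∀ i, Continuous (G i)) →
      (∀ i x, HasDerivAt (fun s => g (Function.update x i s)) (G i x) (x i)) →
      Integrable (fun x => Real.exp (g x)) → Integrable (fun x => g x * Real.exp (g x)) →
      (∀ i, Integrable fun x => |G i x| ^ p * Real.exp (g x)) →
      Integrable (fun x => E x * Real.exp (g x)) →
      (∀ x z, -∑ i, z i * G i x ≤ C z + E x) →
      ∫ x, g x * Real.exp (g x) ≤
        (∫ x, Real.exp (g x)) *
          (Real.log (∫ x, Real.exp (g x)) - Real.log (∫ z, Real.exp (-C z)) - n) +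
        ∫ x, E x * Real.exp (g x) := by
  have hp0 : 0 < p := hpq.pos
  have hq0 : 0 < q := hpq.symm.pos
  intro n
  induction n with
  | zero =>
    intro C g G E _ _ _ _ _ _ _ _ _ hY
    simp only [integral_unique]
    -- In dimension zero this reads `0 ≤ C + E`; multiplied by `e^g` it is the claim.
    have := hY (@default _ Unique.instInhabited) (@default _ Unique.instInhabited)
    have h1 : (volume : Measure (Fin 0 → ℝ)).real univ = 1 := by
      simp [measureReal_def, volume_pi]
    simp only [h1, one_smul, Real.log_exp, Finset.univ_eq_empty, Finset.sum_empty, neg_zero,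
      Nat.cast_zero] at this ⊢
    linarith [mul_nonneg this (Real.exp_pos (g (@default _ Unique.instInhabited))).le]
  | succ n ih =>
    intro C g G E hC hCb hg hG hgG hf hgf hGf hEf hY
    have hcons : Continuous fun x : ℝ × (Fin n → ℝ) => (Fin.cons x.1 x.2 : Fin (n + 1) → ℝ) :=
      Continuous.finCons (A := fun _ => ℝ) continuous_fst continuous_snd
    obtain ⟨hks, hkc, hki, hkq⟩ := marginal_exp_neg hq0 hc hC hCb
    -- the density, its derivative in the first variable, and the two marginals
    set f : ℝ × (Fin n → ℝ) → ℝ := fun x => Real.exp (g (Fin.cons x.1 x.2)) with hfdef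
    set G₀ : ℝ × (Fin n → ℝ) → ℝ := fun x => G 0 (Fin.cons x.1 x.2) with hG₀def
    have hfpos : ∀ x, 0 < f x := fun x => Real.exp_pos _
    have hfcont : Continuous f := Real.continuous_exp.comp (hg.comp hcons)
    have hG₀cont : Continuous G₀ := (hG 0).comp hcons
    have hfi : Integrable f (volume.prod volume) := integrable_comp_cons hf
    have hGp : Integrable (fun x => |G₀ x| ^ p * f x) (volume.prod volume) := integrable_comp_cons (hGf 0)
    have hd : ∀ (y : Fin n → ℝ) t, HasDerivAt (fun s => f (s, y)) (G₀ (t, y) * f (t, y)) t := by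
      intro y t
      have := (hgG 0 (Fin.cons t y)).exp
      simp only [Fin.update_cons_zero, Fin.cons_zero] at this
      simpa [hfdef, hG₀def, mul_comm] using this
    have hDi : Integrable (fun x => G₀ x * f x) (volume.prod volume) := by
      refine (hGp.add hfi).mono' (hG₀cont.mul hfcont).aestronglyMeasurable
        (Eventually.of_forall fun x => ?_)
      rw [norm_mul, Real.norm_of_nonneg (hfpos x).le, Real.norm_eq_abs]
      have := mul_le_mul_of_nonneg_right (le_rpow_add_one hpq (abs_nonneg (G₀ x))) (hfpos x).le
      simp only [Pi.add_apply]
      linarith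
    obtain ⟨hfs, hmc⟩ := integrable_slice_and_continuous_marginal hd
      (fun t => (hfcont.comp (Continuous.prodMk_right t)).aestronglyMeasurable) hfi hDi
    have hmi : Integrable fun t => ∫ y, f (t, y) := hfi.integral_prod_left
    have hmpos : ∀ t, 0 < ∫ y, f (t, y) := fun t => integral_exp_pos (hfs t)
    have hkpos : ∀ s, 0 < ∫ z : Fin n → ℝ, Real.exp (-C (Fin.cons s z)) := fun s =>
      integral_exp_pos (hks s)
    have hM : ∫ x, Real.exp (g x) = ∫ t, ∫ y, f (t, y) := by
      rw [← integral_prod _ hfi, ← integral_comp_cons]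
    have hL : ∫ z, Real.exp (-C z) = ∫ s, ∫ z : Fin n → ℝ, Real.exp (-C (Fin.cons s z)) := by
      rw [← integral_comp_cons]
      exact integral_prod _ (integrable_comp_cons (integrable_exp_neg_of_le hq0 hc hC hCb))
    have hMpos : 0 < ∫ x, Real.exp (g x) := integral_exp_pos hf
    have hLpos : 0 < ∫ z, Real.exp (-C z) :=
      integral_exp_pos (integrable_exp_neg_of_le hq0 hc hC hCb)
    obtain ⟨T, T', hT'c, hT, hT', hTk⟩ := exists_transport hmc hkc hmpos hkpos hmi hki
    have hTc : Continuous T := continuous_iff_continuousAt.2 fun t => (hT t).continuousAt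
    rw [← hM, ← hL] at hTk
    -- moments of the transport
    have hTq : Integrable (fun x => |T x.1| ^ q * f x) (volume.prod volume) := by
      have h1 := integrable_comp_transport hT hT' hTk hkq
      refine (integrable_prod_iff ?_).2 ⟨Eventually.of_forall fun t =>
        (hfs t).const_mul (|T t| ^ q), ?_⟩
      · exact (((hTc.comp continuous_fst).abs.rpow_const fun _ => Or.inr hq0.le).mul
          hfcont).aestronglyMeasurable
      · refine h1.congr (Eventually.of_forall fun t => ?_)
        simp only [norm_mul, Real.norm_of_nonneg (Real.rpow_nonneg (abs_nonneg _) q),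
          Real.norm_of_nonneg (hfpos _).le]
        rw [integral_const_mul]
    have hTf : Integrable (fun x => T x.1 * f x) (volume.prod volume) := by
      refine (hTq.add hfi).mono' ((hTc.comp continuous_fst).mul hfcont).aestronglyMeasurable
        (Eventually.of_forall fun x => ?_)
      rw [norm_mul, Real.norm_of_nonneg (hfpos x).le, Real.norm_eq_abs]
      have := mul_le_mul_of_nonneg_right (le_rpow_add_one hpq.symm (abs_nonneg (T x.1)))
        (hfpos x).le
      simp only [Pi.add_apply]
      linarith
    -- Young's inequality splits `|G₀| |T|` into `|G₀|^p`, integrable by hypothesis, and `|T|^q`,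
    -- integrable by transport.
    have hTD : Integrable (fun x => T x.1 * (G₀ x * f x)) (volume.prod volume) := by
      refine (hGp.add hTq).mono' ((hTc.comp continuous_fst).mul
        (hG₀cont.mul hfcont)).aestronglyMeasurable (Eventually.of_forall fun x => ?_)
      rw [norm_mul, norm_mul, Real.norm_of_nonneg (hfpos x).le, Real.norm_eq_abs, Real.norm_eq_abs]
      have := mul_le_mul_of_nonneg_right
        (mul_le_rpow_add_rpow hpq (abs_nonneg (G₀ x)) (abs_nonneg (T x.1))) (hfpos x).le
      simp only [Pi.add_apply]
      linarith
    obtain ⟨hT'f, hparts⟩ := integral_prod_deriv_mul_eq_of_nonneg hd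
      (fun y => (hG₀cont.mul hfcont).comp (Continuous.prodMk_left y)) (fun x => (hfpos x).le)
      hT hT'c (fun t => (hT' t).le) hfcont.aestronglyMeasurable hTf hTD
    -- the inequality on almost every slice
    have hEi : Integrable (fun x : ℝ × (Fin n → ℝ) => E (Fin.cons x.1 x.2) * f x)
      (volume.prod volume) := integrable_comp_cons hEf
    have hgi : Integrable (fun x : ℝ × (Fin n → ℝ) => g (Fin.cons x.1 x.2) * f x)
      (volume.prod volume) := integrable_comp_cons hgf
    have hGi : ∀ i : Fin n, Integrable (fun x : ℝ × (Fin n → ℝ) =>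
        |G i.succ (Fin.cons x.1 x.2)| ^ p * f x) (volume.prod volume) := fun i =>
      integrable_comp_cons (hGf i.succ)
    have hslice : ∀ᵐ t, ∫ y, g (Fin.cons t y) * f (t, y) ≤
        (∫ y, f (t, y)) * (Real.log (∫ x, Real.exp (g x)) - Real.log (∫ z, Real.exp (-C z)) -
          (n + 1)) + (∫ y, T' t * f (t, y)) + (∫ y, E (Fin.cons t y) * f (t, y)) +
          ∫ y, T t * (G₀ (t, y) * f (t, y)) := by
      filter_upwards [hgi.prod_right_ae, hEi.prod_right_ae, hTD.prod_right_ae,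
        ae_all_iff.2 fun i => (hGi i).prod_right_ae] with t ht1 ht2 ht3 ht4
      have hsum : ∀ y : Fin n → ℝ, (E (Fin.cons t y) + T t * G₀ (t, y)) * f (t, y) =
        E (Fin.cons t y) * f (t, y) + T t * (G₀ (t, y) * f (t, y)) := fun y => by ring
      -- The first term of the Young pairing is absorbed into `E`; this is why `E` is an arbitrary
      -- function rather than the Legendre transform. The constants `c` and `b` survive because `c *
      -- |T t| ^ q ≥ 0` can be dropped.
      have h := ih (fun z => C (Fin.cons (T t) z)) (fun y => g (Fin.cons t y))
        (fun i y => G i.succ (Fin.cons t y)) (fun y => E (Fin.cons t y) + T t * G₀ (t, y))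
        (hC.comp (hcons.comp (Continuous.prodMk_right _))) (fun z => ?_)
        (hg.comp (hcons.comp (Continuous.prodMk_right _)))
        (fun i => (hG i.succ).comp (hcons.comp (Continuous.prodMk_right _)))
        (fun i y => ?_) (hfs t) ht1 ht4 ?_ (fun y z => ?_)
      · change _ ≤ (∫ y, f (t, y)) * (Real.log (∫ y, f (t, y)) - _ - _) +
          ∫ y, (E (Fin.cons t y) + T t * G₀ (t, y)) * f (t, y) at h
        simp_rw [hsum] at h
        rw [integral_add ht2 ht3] at h
        refine h.trans ?_
        have := mul_log_le_of_transport hMpos hLpos (hkpos (T t)) (hT' t) (hmpos t).le (hTk t)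
        rw [integral_const_mul (T' t)]
        linarith
      · have := hCb (Fin.cons (T t) z)
        rw [Fin.sum_univ_succ] at this
        simp only [Fin.cons_zero, Fin.cons_succ] at this
        have h0 : 0 ≤ c * |T t| ^ q := mul_nonneg hc.le (Real.rpow_nonneg (abs_nonneg _) _)
        linarith
      · have := hgG i.succ (Fin.cons t y)
        simpa only [Fin.cons_update, Fin.cons_succ] using this
      · exact (ht2.add ht3).congr (Eventually.of_forall fun y => (hsum y).symm)
      · have := hY (Fin.cons t y) (Fin.cons (T t) z)
        rw [Fin.sum_univ_succ] at this
        simp only [Fin.cons_zero, Fin.cons_succ] at this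
        simp only [hG₀def]
        linarith
    -- After integration in `t`, `hparts` cancels the `T'` term against the `T * G₀` term.
    have hint := integral_mono_ae hgi.integral_prod_left
      ((((hmi.mul_const _).add hT'f.integral_prod_left).add hEi.integral_prod_left).add
        hTD.integral_prod_left) hslice
    rw [integral_add' (((hmi.mul_const _).add hT'f.integral_prod_left).add hEi.integral_prod_left)
        hTD.integral_prod_left,
      integral_add' ((hmi.mul_const _).add hT'f.integral_prod_left) hEi.integral_prod_left,
      integral_add' (hmi.mul_const _) hT'f.integral_prod_left, integral_mul_const,
      ← integral_prod _ hgi, ← integral_prod _ hT'f, ← integral_prod _ hEi, ← integral_prod _ hTD,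
      ← hM, hparts] at hint
    rw [← integral_comp_cons fun x => g x * Real.exp (g x),
      ← integral_comp_cons fun x => E x * Real.exp (g x)]
    simp only [Pi.mul_apply, hfdef] at hint
    push_cast
    linarith

end

/-! ### Homogeneous strictly convex functions and their Legendre transforms -/

section Homogeneous

variable {n : ℕ} {p q : ℝ} {C : EuclideanSpace ℝ (Fin n) → ℝ}

/-- Strict convexity at the midpoint of `0` and `x` fixes the sign of `C x` from that of `2^{-q} -
1/2`. If `q ≤ 1`, then `C < 0` off the origin, against convexity at the midpoint `0` of `e` and
`-e`. -/
lemma IsHomogeneousOfDegree.one_lt_and_pos (hn : 1 ≤ n) (hconv : StrictConvexOn ℝ univ C)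
    (hhom : IsHomogeneousOfDegree q C) : 1 < q ∧ C 0 = 0 ∧ ∀ x, x ≠ 0 → 0 < C x := by
  have : Nontrivial (EuclideanSpace ℝ (Fin n)) := by
    have : Nonempty (Fin n) := ⟨⟨0, hn⟩⟩
    infer_instance
  obtain ⟨e, he⟩ := exists_ne (0 : EuclideanSpace ℝ (Fin n))
  have hmid : ∀ x y, x ≠ y → C ((1 / 2 : ℝ) • x + (1 / 2 : ℝ) • y) < 1 / 2 * C x + 1 / 2 * C y :=
    fun x y hxy => hconv.2 (mem_univ x) (mem_univ y) hxy (by norm_num) (by norm_num) (by norm_num)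
  have hhalf : ∀ x, x ≠ 0 → (1 / 2 : ℝ) ^ q * C x < 1 / 2 * C 0 + 1 / 2 * C x := fun x hx => by
    have := hmid 0 x hx.symm
    rwa [smul_zero, zero_add, hhom _ (by norm_num)] at this
  have hq0 : q ≠ 0 := by
    rintro rfl
    have h1 := hhalf e he
    have h2 := hhom 0 le_rfl e
    simp only [zero_smul, Real.rpow_zero, one_mul] at h1 h2
    linarith
  -- `0 ^ q = 0` for every nonzero real `q`, negative ones included.
  have hC0 : C 0 = 0 := by
    have := hhom 0 le_rfl 0
    rwa [zero_smul, Real.zero_rpow hq0, zero_mul] at this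
  have hq : 1 < q := by
    by_contra! h
    have hle : (1 / 2 : ℝ) ≤ (1 / 2 : ℝ) ^ q := by
      simpa using Real.rpow_le_rpow_of_exponent_ge (x := 1 / 2) (by norm_num) (by norm_num) h
    have hneg : ∀ x, x ≠ 0 → C x < 0 := fun x hx => by
      have := hhalf x hx
      by_contra! h0
      nlinarith
    have h1 := hmid e (-e) fun h => he (by
      have h2 : (2 : ℝ) • e = 0 := by rw [two_smul]; exact add_eq_zero_iff_eq_neg.2 h
      simpa using h2)
    rw [smul_neg, add_neg_cancel, hC0] at h1
    linarith [hneg e he, hneg (-e) (neg_ne_zero.2 he)]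
  refine ⟨hq, hC0, fun x hx => ?_⟩
  have hlt : (1 / 2 : ℝ) ^ q < 1 / 2 := by
    simpa using Real.rpow_lt_rpow_of_exponent_gt (x := 1 / 2) (by norm_num) (by norm_num) hq
  have := hhalf x hx
  by_contra! h0
  nlinarith

/-- The constants are the extrema of `C` on the compact unit sphere; homogeneity does the rest. -/
lemma IsHomogeneousOfDegree.exists_bounds (hn : 1 ≤ n) (hconv : StrictConvexOn ℝ univ C)
    (hhom : IsHomogeneousOfDegree q C) :
    ∃ c A : ℝ, 0 < c ∧ 0 < A ∧ ∀ x, c * ‖x‖ ^ q ≤ C x ∧ C x ≤ A * ‖x‖ ^ q := by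
  obtain ⟨hq, hC0, hpos⟩ := hhom.one_lt_and_pos hn hconv
  have : Nontrivial (EuclideanSpace ℝ (Fin n)) := by
    have : Nonempty (Fin n) := ⟨⟨0, hn⟩⟩
    infer_instance
  have hcont : Continuous C := continuousOn_univ.1 (hconv.convexOn.continuousOn isOpen_univ)
  have hne : (Metric.sphere (0 : EuclideanSpace ℝ (Fin n)) 1).Nonempty :=
    NormedSpace.sphere_nonempty.2 zero_le_one
  obtain ⟨u, hu, hmin⟩ := (isCompact_sphere (0 : EuclideanSpace ℝ (Fin n)) 1).exists_isMinOn hne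
    hcont.continuousOn
  obtain ⟨v, hv, hmax⟩ := (isCompact_sphere (0 : EuclideanSpace ℝ (Fin n)) 1).exists_isMaxOn hne
    hcont.continuousOn
  have hne0 : ∀ w ∈ Metric.sphere (0 : EuclideanSpace ℝ (Fin n)) 1, w ≠ 0 := fun w hw =>
    ne_zero_of_mem_unit_sphere ⟨w, hw⟩
  refine ⟨C u, C v, hpos u (hne0 u hu), hpos v (hne0 v hv), fun x => ?_⟩
  rcases eq_or_ne x 0 with rfl | hx
  · simp [hC0, Real.zero_rpow (by linarith : q ≠ 0)]
  · have hw : ‖x‖⁻¹ • x ∈ Metric.sphere (0 : EuclideanSpace ℝ (Fin n)) 1 := by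
      simp [norm_smul, hx]
    have hx' : C x = ‖x‖ ^ q * C (‖x‖⁻¹ • x) := by
      rw [← hhom _ (norm_nonneg x), smul_inv_smul₀ (norm_ne_zero_iff.2 hx)]
    have h0 : 0 ≤ ‖x‖ ^ q := Real.rpow_nonneg (norm_nonneg x) q
    rw [hx', mul_comm (C u), mul_comm (C v)]
    exact ⟨mul_le_mul_of_nonneg_left (hmin hw) h0, mul_le_mul_of_nonneg_left (hmax hw) h0⟩

variable {c A : ℝ}

lemma bddAbove_legendre (hpq : p.HolderConjugate q) (hc : 0 < c)
    (hlow : ∀ x, c * ‖x‖ ^ q ≤ C x) (y : EuclideanSpace ℝ (Fin n)) :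
    BddAbove (range fun z : EuclideanSpace ℝ (Fin n) => inner ℝ z y - C z) := by
  have hq0 : q ≠ 0 := hpq.symm.ne_zero
  -- Young's inequality with the weight `c ^ q⁻¹` moved onto `‖z‖`, so that the second power is
  -- exactly `c * ‖z‖ ^ q ≤ C z`.
  refine ⟨(‖y‖ * (c ^ q⁻¹)⁻¹) ^ p, ?_⟩
  rintro _ ⟨z, rfl⟩
  have hcq : 0 < c ^ q⁻¹ := Real.rpow_pos_of_pos hc _
  have h1 := mul_le_rpow_add_rpow hpq (mul_nonneg (norm_nonneg y) (inv_nonneg.2 hcq.le))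
    (mul_nonneg hcq.le (norm_nonneg z))
  rw [Real.mul_rpow hcq.le (norm_nonneg z), Real.rpow_inv_rpow hc.le hq0] at h1
  have h2 : ‖y‖ * (c ^ q⁻¹)⁻¹ * (c ^ q⁻¹ * ‖z‖) = ‖z‖ * ‖y‖ := by
    field_simp
  have h3 := real_inner_le_norm z y
  have h4 := hlow z
  simp only
  linarith

lemma inner_le_add_legendre (hpq : p.HolderConjugate q) (hc : 0 < c)
    (hlow : ∀ x, c * ‖x‖ ^ q ≤ C x) (z y : EuclideanSpace ℝ (Fin n)) :
    inner ℝ z y ≤ C z + legendre C y := by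
  have := le_ciSup (bddAbove_legendre hpq hc hlow y) z
  simp only [legendre]
  linarith

/-- The Young inequality for `C` and its Legendre transform, rescaled by homogeneity. -/
lemma mul_inner_le_add_legendre (hpq : p.HolderConjugate q) (hc : 0 < c)
    (hlow : ∀ x, c * ‖x‖ ^ q ≤ C x) (hhom : IsHomogeneousOfDegree q C) {r : ℝ} (hr : 0 < r)
    (z y : EuclideanSpace ℝ (Fin n)) : r * inner ℝ z y ≤ C z + r ^ p * legendre C y := by
  -- Since `(1 - p) * q = -p`, multiplying by `r ^ p` restores the coefficient 1 in front of `C z`.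
  have h := inner_le_add_legendre hpq hc hlow (r ^ (1 - p) • z) y
  rw [hhom _ (Real.rpow_nonneg hr.le _), real_inner_smul_left, ← Real.rpow_mul hr.le] at h
  have hrp : 0 < r ^ p := Real.rpow_pos_of_pos hr p
  have h' := mul_le_mul_of_nonneg_left h hrp.le
  have h1 : r ^ p * r ^ (1 - p) = r := by
    rw [← Real.rpow_add hr]; simp
  have h2 : r ^ p * r ^ ((1 - p) * q) = 1 := by
    rw [← Real.rpow_add hr]
    have h3 := hpq.sub_one_mul_conj
    rw [show p + (1 - p) * q = 0 by linarith, Real.rpow_zero]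
  rw [mul_add, ← mul_assoc, ← mul_assoc, h1, h2, one_mul] at h'
  exact h'

/-- Turns integrability of `C*(-∇g) e^g` into that of `|∂ᵢg|^p e^g`. The supremum is tested at `ε
‖y‖^(p-2) y`. -/
lemma exists_le_legendre (hpq : p.HolderConjugate q) (hc : 0 < c) (hA : 0 < A)
    (hlow : ∀ x, c * ‖x‖ ^ q ≤ C x) (hup : ∀ x, C x ≤ A * ‖x‖ ^ q) :
    ∃ κ : ℝ, 0 < κ ∧ ∀ y, κ * ‖y‖ ^ p ≤ legendre C y := by
  have hp0 : 0 < p := hpq.pos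
  have hq0 : 0 < q := hpq.symm.pos
  have hq1 : 0 < q - 1 := hpq.symm.sub_one_pos
  -- Chosen so that `A ε^q = ε / 2`: the cost takes only half of the pairing `ε ‖y‖^p`.
  set ε : ℝ := ((2 * A)⁻¹) ^ (q - 1)⁻¹ with hε
  have hA2 : 0 < (2 * A)⁻¹ := by positivity
  have hεpos : 0 < ε := Real.rpow_pos_of_pos hA2 _
  have hεq : A * ε ^ q = ε / 2 := by
    have : ε ^ (q - 1) = (2 * A)⁻¹ := Real.rpow_inv_rpow hA2.le hq1.ne'
    rw [show q = (q - 1) + 1 by ring, Real.rpow_add hεpos, this, Real.rpow_one]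
    field_simp
  refine ⟨ε / 2, by positivity, fun y => ?_⟩
  rcases eq_or_ne y 0 with rfl | hy
  · have h1 := inner_le_add_legendre hpq hc hlow 0 0
    have h2 := hup 0
    simp only [norm_zero, Real.zero_rpow hp0.ne', Real.zero_rpow hq0.ne', mul_zero,
      inner_zero_left] at h1 h2 ⊢
    linarith
  · have hy0 : 0 < ‖y‖ := norm_pos_iff.2 hy
    have hpow : 0 < ‖y‖ ^ (p - 2) := Real.rpow_pos_of_pos hy0 _
    have h1 := inner_le_add_legendre hpq hc hlow ((ε * ‖y‖ ^ (p - 2)) • y) y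
    have h2 := hup ((ε * ‖y‖ ^ (p - 2)) • y)
    have hn : ‖(ε * ‖y‖ ^ (p - 2)) • y‖ = ε * ‖y‖ ^ (p - 1) := by
      rw [norm_smul, Real.norm_of_nonneg (by positivity), mul_assoc,
        show p - 1 = (p - 2) + 1 by ring, Real.rpow_add hy0, Real.rpow_one]
    have hi : inner ℝ ((ε * ‖y‖ ^ (p - 2)) • y) y = ε * ‖y‖ ^ p := by
      rw [real_inner_smul_left, real_inner_self_eq_norm_sq, mul_assoc, ← Real.rpow_natCast,
        ← Real.rpow_add hy0]
      norm_num
    have hqp : (‖y‖ ^ (p - 1)) ^ q = ‖y‖ ^ p := by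
      rw [← Real.rpow_mul hy0.le, hpq.sub_one_mul_conj]
    rw [hn, Real.mul_rpow hεpos.le (Real.rpow_nonneg hy0.le _), hqp, ← mul_assoc, hεq] at h2
    rw [hi] at h1
    linarith

end Homogeneous

/-! ### Transfer to Euclidean space and optimisation over dilations -/

section Euclidean

variable {n : ℕ} {p q : ℝ}

lemma hasDerivAt_comp_toLp_update {g : EuclideanSpace ℝ (Fin n) → ℝ} (hg : ContDiff ℝ 1 g)
    (i : Fin n) (x : Fin n → ℝ) :
    HasDerivAt (fun s => g (WithLp.toLp 2 (Function.update x i s)))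
      (gradient g (WithLp.toLp 2 x) i) (x i) := by
  have h1 : HasDerivAt (fun s => (WithLp.toLp 2 (Function.update x i s) : EuclideanSpace ℝ (Fin n)))
      (EuclideanSpace.single i 1) (x i) :=
    ((PiLp.continuousLinearEquiv 2 ℝ fun _ : Fin n => ℝ).symm.toContinuousLinearMap.hasFDerivAt).comp_hasDerivAt
      (x i) (hasDerivAt_update x i (x i))
  have h2 : HasFDerivAt g (InnerProductSpace.toDual ℝ _ (gradient g (WithLp.toLp 2 x)))
      (WithLp.toLp 2 (Function.update x i (x i))) := by
    rw [Function.update_eq_self]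
    exact ((hg.differentiable one_ne_zero) (WithLp.toLp 2 x)).hasGradientAt.hasFDerivAt
  have h3 := h2.comp_hasDerivAt (x i) h1
  rw [InnerProductSpace.toDual_apply_apply, EuclideanSpace.inner_single_right, one_mul,
    RCLike.conj_to_real] at h3
  exact h3

lemma continuous_gradient {g : EuclideanSpace ℝ (Fin n) → ℝ} (hg : ContDiff ℝ 1 g) :
    Continuous (gradient g) :=
  (InnerProductSpace.toDual ℝ (EuclideanSpace ℝ (Fin n))).symm.continuous.comp
    (hg.continuous_fderiv one_ne_zero)

lemma integrable_comp_toLp {h : EuclideanSpace ℝ (Fin n) → ℝ} (hi : Integrable h) :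
    Integrable fun x : Fin n → ℝ => h (WithLp.toLp 2 x) :=
  ((PiLp.volume_preserving_toLp (Fin n)).integrable_comp_emb
    (MeasurableEquiv.toLp 2 (Fin n → ℝ)).measurableEmbedding).2 hi

lemma integral_comp_toLp (h : EuclideanSpace ℝ (Fin n) → ℝ) :
    ∫ x : Fin n → ℝ, h (WithLp.toLp 2 x) = ∫ x, h x :=
  (PiLp.volume_preserving_toLp (Fin n)).integral_comp
    (MeasurableEquiv.toLp 2 (Fin n → ℝ)).measurableEmbedding h

variable {C g : EuclideanSpace ℝ (Fin n) → ℝ}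

/-- The nonhomogeneous logarithmic Sobolev inequality for every dilation of `C`. -/
lemma integral_mul_exp_le_of_dilation (hn : 1 ≤ n) (hpq : p.HolderConjugate q)
    (hconv : StrictConvexOn ℝ univ C) (hhom : IsHomogeneousOfDegree q C) (hg : ContDiff ℝ 1 g)
    (hint : Integrable fun x => Real.exp (g x))
    (hent : Integrable fun x => g x * Real.exp (g x))
    (hgrad : Integrable fun x => legendre C (-gradient g x) * Real.exp (g x)) :
    0 < ∫ x, Real.exp (-C x) ∧ ∀ r : ℝ, 0 < r → ∫ x, g x * Real.exp (g x) ≤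
      (∫ x, Real.exp (g x)) * (Real.log (∫ x, Real.exp (g x)) -
        (n * Real.log r + Real.log (∫ x, Real.exp (-C x))) - n) +
        r ^ p * ∫ x, legendre C (-gradient g x) * Real.exp (g x) := by
  obtain ⟨c, A, hc, hA, hbd⟩ := hhom.exists_bounds hn hconv
  have hlow := fun x => (hbd x).1
  obtain ⟨κ, hκ, hleg⟩ := exists_le_legendre hpq hc hA hlow fun x => (hbd x).2
  have hp0 : 0 < p := hpq.pos
  have hq0 : 0 < q := hpq.symm.pos
  have hn0 : (0 : ℝ) < n := Nat.cast_pos.2 hn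
  have hcont : Continuous C := continuousOn_univ.1 (hconv.convexOn.continuousOn isOpen_univ)
  have hto : Continuous (WithLp.toLp 2 : (Fin n → ℝ) → EuclideanSpace ℝ (Fin n)) :=
    PiLp.continuous_toLp 2 _
  have hcoord : ∀ (x : EuclideanSpace ℝ (Fin n)) i, |x i| ≤ ‖x‖ := fun x i =>
    PiLp.norm_apply_le x i
  have hCr : ∀ r : ℝ, 0 < r → ∀ z : Fin n → ℝ,
      c * (r⁻¹) ^ q / n * ∑ i, |z i| ^ q - 0 ≤ C (r⁻¹ • WithLp.toLp 2 z) := fun r hr z => by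
    rw [hhom _ (inv_nonneg.2 hr.le)]
    have hs : ∑ i, |z i| ^ q ≤ n * ‖(WithLp.toLp 2 z : EuclideanSpace ℝ (Fin n))‖ ^ q := by
      refine (Finset.sum_le_card_nsmul _ _ _ fun i _ => Real.rpow_le_rpow (abs_nonneg _)
        (hcoord (WithLp.toLp 2 z) i) hq0.le).trans_eq ?_
      simp
    have hr0 : 0 ≤ (r⁻¹) ^ q := Real.rpow_nonneg (inv_nonneg.2 hr.le) q
    calc c * (r⁻¹) ^ q / n * ∑ i, |z i| ^ q - 0
        ≤ c * (r⁻¹) ^ q / n * (n * ‖(WithLp.toLp 2 z : EuclideanSpace ℝ (Fin n))‖ ^ q) := by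
          rw [sub_zero]
          exact mul_le_mul_of_nonneg_left hs (by positivity)
      _ = (r⁻¹) ^ q * (c * ‖(WithLp.toLp 2 z : EuclideanSpace ℝ (Fin n))‖ ^ q) := by
          field_simp
      _ ≤ _ := mul_le_mul_of_nonneg_left (hlow _) hr0
  have hCcont : ∀ r : ℝ, Continuous fun z : Fin n → ℝ => C (r⁻¹ • WithLp.toLp 2 z) := fun r =>
    hcont.comp (by fun_prop)
  have hL : ∀ r : ℝ, 0 < r → ∫ z : Fin n → ℝ, Real.exp (-C (r⁻¹ • WithLp.toLp 2 z)) =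
      r ^ n * ∫ x, Real.exp (-C x) := fun r hr => by
    rw [integral_comp_toLp fun x => Real.exp (-C (r⁻¹ • x)),
      Measure.integral_comp_inv_smul volume (fun x => Real.exp (-C x)) r]
    simp [abs_of_pos (pow_pos hr n)]
  have hLpos : 0 < ∫ x, Real.exp (-C x) := by
    have := integral_exp_pos (integrable_exp_neg_of_le hq0 (by positivity) (hCcont 1)
      (hCr 1 one_pos))
    rwa [hL 1 one_pos, one_pow, one_mul] at this
  refine ⟨hLpos, fun r hr => ?_⟩
  have hG : ∀ i : Fin n, Continuous fun x : Fin n → ℝ => gradient g (WithLp.toLp 2 x) i := fun i =>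
    (EuclideanSpace.proj i).continuous.comp ((continuous_gradient hg).comp hto)
  have hGp : ∀ i : Fin n, Integrable fun x : Fin n → ℝ =>
      |gradient g (WithLp.toLp 2 x) i| ^ p * Real.exp (g (WithLp.toLp 2 x)) := fun i => by
    refine ((integrable_comp_toLp hgrad).const_mul κ⁻¹).mono'
      (((hG i).abs.rpow_const fun _ => Or.inr hp0.le).mul
        (Real.continuous_exp.comp (hg.continuous.comp hto))).aestronglyMeasurable
      (Eventually.of_forall fun x => ?_)
    rw [Real.norm_of_nonneg (by positivity), ← mul_assoc]
    refine mul_le_mul_of_nonneg_right ?_ (Real.exp_pos _).le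
    have h1 := hleg (-gradient g (WithLp.toLp 2 x))
    rw [norm_neg] at h1
    rw [le_inv_mul_iff₀ hκ]
    exact (mul_le_mul_of_nonneg_left
      (Real.rpow_le_rpow (abs_nonneg _) (hcoord _ i) hp0.le) hκ.le).trans h1
  have hEr : ∀ x : EuclideanSpace ℝ (Fin n),
      r ^ p * legendre C (-gradient g x) * Real.exp (g x) =
        r ^ p * (legendre C (-gradient g x) * Real.exp (g x)) := fun x => mul_assoc _ _ _
  have key := integral_mul_exp_le_of_young (b := 0) hpq
    (by positivity : 0 < c * (r⁻¹) ^ q / n) n (fun z => C (r⁻¹ • WithLp.toLp 2 z))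
    (fun x => g (WithLp.toLp 2 x)) (fun i x => gradient g (WithLp.toLp 2 x) i)
    (fun x => r ^ p * legendre C (-gradient g (WithLp.toLp 2 x)))
    (hCcont r) (hCr r hr) (hg.continuous.comp hto) hG (hasDerivAt_comp_toLp_update hg)
    (integrable_comp_toLp hint) (integrable_comp_toLp hent) hGp
    (by simp_rw [hEr]; exact (integrable_comp_toLp hgrad).const_mul _) (fun x z => ?_)
  · simp_rw [hEr] at key
    rw [hL r hr, Real.log_mul (pow_pos hr n).ne' hLpos.ne', Real.log_pow, integral_const_mul,
      integral_comp_toLp fun x => g x * Real.exp (g x), integral_comp_toLp fun x => Real.exp (g x),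
      integral_comp_toLp fun x => legendre C (-gradient g x) * Real.exp (g x)] at key
    exact key
  · have h := mul_inner_le_add_legendre hpq hc hlow hhom hr (r⁻¹ • WithLp.toLp 2 z)
      (-gradient g (WithLp.toLp 2 x))
    rw [real_inner_smul_left, mul_inv_cancel_left₀ hr.ne', inner_neg_right] at h
    refine le_trans (le_of_eq ?_) h
    rw [PiLp.inner_apply]
    simp only [RCLike.inner_apply, RCLike.conj_to_real, mul_comm]

lemma entropy_exp_eq {X : Type*} [MeasurableSpace X] {μ : Measure X} {g : X → ℝ}
    (hpos : 0 < ∫ x, Real.exp (g x) ∂μ) (hint : Integrable (fun x => Real.exp (g x)) μ)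
    (hent : Integrable (fun x => g x * Real.exp (g x)) μ) :
    entropy μ (fun x => Real.exp (g x)) = (∫ x, g x * Real.exp (g x) ∂μ) -
      (∫ x, Real.exp (g x) ∂μ) * Real.log (∫ x, Real.exp (g x) ∂μ) := by
  rw [entropy, ← integral_mul_const, ← integral_sub hent (hint.mul_const _)]
  refine integral_congr_ae (Eventually.of_forall fun x => ?_)
  simp only [Real.log_div (Real.exp_pos (g x)).ne' hpos.ne', Real.log_exp]
  ring

/-- Optimisation over dilations. -/
lemma le_mul_log_of_forall_dilation {n p S M L I : ℝ} (hn : 0 < n) (hp : 0 < p) (hM : 0 < M)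
    (hL : 0 < L)
    (h : ∀ r : ℝ, 0 < r → S ≤ -(M * (n * Real.log r + Real.log L + n)) + r ^ p * I) :
    S ≤ n / p * M * Real.log (p / (n * Real.exp (p - 1) * L ^ (p / n)) * (I / M)) := by
  have hI : 0 < I := by
    by_contra! hI
    -- If `I ≤ 0`, a large dilation is contradictory: this `r` makes the bracket equal to `-S + M`,
    -- whence `S ≤ S - M`.
    have h1 := h (Real.exp ((-(S / M) - Real.log L - n + 1) / n)) (Real.exp_pos _)
    rw [Real.log_exp, mul_div_cancel₀ _ hn.ne'] at h1
    have h2 := mul_nonpos_of_nonneg_of_nonpos (Real.rpow_nonneg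
      (Real.exp_pos ((-(S / M) - Real.log L - n + 1) / n)).le p) hI
    have h3 : M * (-(S / M) - Real.log L - n + 1 + Real.log L + n) = -S + M := by
      field_simp
      ring
    linarith
  have ht : 0 < n * M / (p * I) := by positivity
  -- The critical point in `r` of the right-hand side: `r ^ p = n * M / (p * I)`.
  have h1 := h ((n * M / (p * I)) ^ p⁻¹) (Real.rpow_pos_of_pos ht _)
  rw [Real.log_rpow ht, Real.rpow_inv_rpow ht.le hp.ne',
    Real.log_div (by positivity) (by positivity), Real.log_mul hn.ne' hM.ne',
    Real.log_mul hp.ne' hI.ne'] at h1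
  rw [Real.log_mul (by positivity) (by positivity), Real.log_div hp.ne' (by positivity),
    Real.log_mul (by positivity) (by positivity), Real.log_mul hn.ne' (Real.exp_pos _).ne',
    Real.log_exp, Real.log_rpow hL, Real.log_div hI.ne' hM.ne']
  refine h1.trans_eq ?_
  field_simp
  ring

end Euclidean

end LogSobolev

theorem mainTheorem6 (n : ℕ) (hn : 1 ≤ n) (p q : ℝ) (hpq : 1 / p + 1 / q = 1)
    (C : EuclideanSpace ℝ (Fin n) → ℝ)
    (hconv : StrictConvexOn ℝ Set.univ C)
    (hhom : LogSobolev.IsHomogeneousOfDegree q C)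
    (g : EuclideanSpace ℝ (Fin n) → ℝ) (hg : ContDiff ℝ 1 g)
    (hint : Integrable (fun x => Real.exp (g x)) volume)
    (hent : Integrable (fun x => g x * Real.exp (g x)) volume)
    (hgrad : Integrable
      (fun x => LogSobolev.legendre C (-gradient g x) * Real.exp (g x)) volume) :
    LogSobolev.entropy volume (fun x => Real.exp (g x)) ≤
      (n : ℝ) / p * (∫ x, Real.exp (g x)) *
        Real.log
          (p / ((n : ℝ) * Real.exp (p - 1) * (∫ x, Real.exp (-C x)) ^ (p / (n : ℝ))) *
            ((∫ x, LogSobolev.legendre C (-gradient g x) * Real.exp (g x)) /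
              ∫ x, Real.exp (g x))) := by
  have hq := (hhom.one_lt_and_pos hn hconv).1
  have hconj : p.HolderConjugate q :=
    (Real.holderConjugate_iff.2 ⟨hq, by simpa [add_comm] using hpq⟩).symm
  obtain ⟨hL, hr⟩ := LogSobolev.integral_mul_exp_le_of_dilation hn hconj hconv hhom hg hint hent
    hgrad
  have hM := integral_exp_pos hint
  refine LogSobolev.le_mul_log_of_forall_dilation (Nat.cast_pos.2 hn) hconj.pos hM hL
    fun r hr0 => ?_
  rw [LogSobolev.entropy_exp_eq hM hint hent]
  linarith [hr r hr0]
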